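/- Let $r,p\ge2$ be integers. For a graph $H$, an $r$-book of size $q$ in $H$ is a (not necessarily induced) subgraph of $H$ isomorphic to $K_r+qK_1$, that is, an $r$-clique (the base) together with $q$ further vertices (the pages), each joined to every vertex of the base; let $bs^{(r)}(H)$ denote the largest size of an $r$-book in $H$ (with $bs^{(r)}(H)=0$ if $H$ has no $r$-clique). For every real $\xi>0$ there exists $n_0=n_0(p,r,\xi)$ such that every $K_{p+1}$-free graph $G$ of order $n\ge n_0$ satisfies at least one of the following: (i) $bs^{(r)}(\overline G)>n/p$, where $\overline G$ is the complement of $G$; (ii) $G$ contains an induced subgraph $G_1$ of order at least $(1-\xi)n$, with chromatic number exactly $p$ and with minimum degree $$\delta(G_1)\ge\Bigl(1-\frac1p-2\xi\Bigr)n.$$ -/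

import Mathlib

/-- The generalized book `K_r + q K_1`: an `r`-clique (the base, `Sum.inl`) together with `q`
further vertices (the pages, `Sum.inr`), each joined to every vertex of the base, with no edges
between pages. -/
def bookGraph (r q : ℕ) : SimpleGraph (Fin r ⊕ Fin q) where
  Adj x y := x ≠ y ∧ (x.isLeft = true ∨ y.isLeft = true)
  symm := ⟨fun _ _ h => ⟨h.1.symm, h.2.symm⟩⟩
  loopless := ⟨fun _ h => h.1 rfl⟩

/-- The size `bs^{(r)}(H)` of the largest `r`-book contained in `H` as a (not necessarily induced)
subgraph. The supremum is over a set which is bounded when `V` is finite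
(see `bddAbove_bookSizes`); it is `0` when `H` has no `r`-clique. -/
noncomputable def bookSize {V : Type*} (r : ℕ) (H : SimpleGraph V) : ℕ :=
  sSup {q : ℕ | (bookGraph r q).IsContained H}

theorem bddAbove_bookSizes {V : Type*} [Finite V] (r : ℕ) (H : SimpleGraph V) :
    BddAbove {q : ℕ | (bookGraph r q).IsContained H} := by
  refine ⟨Nat.card V, ?_⟩
  rintro q ⟨f⟩
  have h := Nat.card_le_card_of_injective f f.injective
  simp only [Nat.card_sum, Nat.card_fin] at h
  omega

theorem exists_book_of_lt_bookSize {V : Type*} [Finite V] {r k : ℕ} {H : SimpleGraph V}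
    (h : k < bookSize r H) : ∃ q, k < q ∧ (bookGraph r q).IsContained H := by
  have hne : {q : ℕ | (bookGraph r q).IsContained H}.Nonempty := by
    by_contra hc
    rw [Set.not_nonempty_iff_eq_empty] at hc
    simp [bookSize, hc] at h
  exact ⟨_, h, Nat.sSup_mem hne (bddAbove_bookSizes r H)⟩

theorem le_bookSize {V : Type*} [Finite V] {r q : ℕ} {H : SimpleGraph V}
    (h : (bookGraph r q).IsContained H) : q ≤ bookSize r H :=
  le_csSup (bddAbove_bookSizes r H) h

/-!
The proof is elementary: it uses Ramsey's theorem, the pigeonhole principle and double counting, but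
neither the regularity lemma nor a stability theorem. Let `n` be the number of vertices.

An independent `r`-set `J` of `G` is the base of a book in the complement whose pages are the common
non-neighbours of `J` outside `J` (`IsNIndepSet.isContained_bookGraph`). So if the first alternative
fails, every independent `r`-set has at most `n / p + r` common non-neighbours (`BookBounded`), and
in particular every independent set has at most `n / p + r` vertices.

Consider `k` independent sets of a large constant size `m`, completely joined to each other
(`IsIndepBlowup`). If many vertices have a fair number of neighbours in every one of these sets, many
of them have the same neighbours there, and Ramsey's theorem yields `k + 1` such sets of smaller
size. Otherwise almost every vertex is nonadjacent to most of one of the sets, so averaging gives an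
`r`-set with about `n / k` common non-neighbours, which is too many for `k < p`. Hence `k = p` can be
reached (`exists_isIndepBlowup`).

For `k = p` every vertex misses one of the sets `M i` entirely, since `G` is `K_{p+1}`-free. Thus the
`p` sets of non-neighbours of the `M i`, each of size at most `n / p + r`, cover all the vertices, so
they overlap in boundedly many vertices, even when one `M i` is replaced by an `r`-subset. It follows
that all but boundedly many vertices miss exactly one `M i` and have fewer than `r` non-neighbours in
each of the others. Two adjacent vertices missing the same `M i` would complete a `K_{p+1}` with
vertices of the other parts, so these classes are independent, and they have size `n / p` up to a
constant (`exists_isIndepSet_partition`).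

Finally, an `r`-subset of one class has only boundedly many common non-neighbours in another class,
because it already has `n / p` of them in its own class. By double counting, only boundedly many
vertices are nonadjacent to a positive proportion of another class
(`exists_card_nonneighbors_le`). Deleting them leaves a `p`-colourable induced subgraph of the
required order and minimum degree (`exists_colorable_induce`). It is not `(p - 1)`-colourable, as a
colour class would be an independent set with more than `n / p + r` vertices
(`BookBounded.mul_card_le_of_colorable`).
-/

namespace SimpleGraph

open Finset
open scoped Classical

variable {V : Type*} {G : SimpleGraph V}

/-! ### Ramsey's theorem and common non-neighbours -/

theorem IsIndepSet.not_adj {s : Set V} (h : G.IsIndepSet s) {a b : V} (ha : a ∈ s) (hb : b ∈ s) :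
    ¬ G.Adj a b := fun hab => h ha hb hab.ne hab

theorem IsIndepSet.mono {s t : Set V} (h : G.IsIndepSet s) (hts : t ⊆ s) : G.IsIndepSet t :=
  Set.Pairwise.mono hts h

/-- Ramsey's theorem for two colours, relative to a set of vertices. -/
theorem exists_forall_isNClique_or_isNIndepSet (a b : ℕ) :
    ∃ N : ℕ, ∀ (V : Type*) (G : SimpleGraph V) (U : Finset V), N ≤ #U →
      (∃ K ⊆ U, G.IsNClique a K) ∨ ∃ I ⊆ U, G.IsNIndepSet b I := by
  induction a generalizing b with
  | zero => exact ⟨0, fun V G U _ => .inl ⟨∅, by simp, by simp⟩⟩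
  | succ a iha =>
    induction b with
    | zero => exact ⟨0, fun V G U _ => .inr ⟨∅, by simp, by simp [isNIndepSet_iff]⟩⟩
    | succ b ihb =>
      obtain ⟨N₁, h₁⟩ := iha (b + 1)
      obtain ⟨N₂, h₂⟩ := ihb
      refine ⟨N₁ + N₂ + 1, fun V G U hU => ?_⟩
      obtain ⟨v, hv⟩ : U.Nonempty := card_pos.1 (by omega)
      have hsplit := card_filter_add_card_filter_not (s := U.erase v) (fun w => G.Adj v w)
      rw [card_erase_of_mem hv] at hsplit
      have hsub : ∀ {P : V → Prop} [DecidablePred P], (U.erase v).filter P ⊆ U :=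
        fun h => (filter_subset _ _).trans (erase_subset _ _) h
      rcases le_or_gt N₁ #{w ∈ U.erase v | G.Adj v w} with h | h
      · rcases h₁ V G _ h with ⟨K, hK, hKc⟩ | ⟨I, hI, hIc⟩
        · refine .inl ⟨insert v K, insert_subset hv (hK.trans hsub), ?_⟩
          exact hKc.insert fun w hw => (mem_filter.1 (hK hw)).2
        · exact .inr ⟨I, hI.trans hsub, hIc⟩
      · rcases h₂ V G {w ∈ U.erase v | ¬ G.Adj v w} (by omega) with ⟨K, hK, hKc⟩ | ⟨I, hI, hIc⟩
        · exact .inl ⟨K, hK.trans hsub, hKc⟩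
        · refine .inr ⟨insert v I, insert_subset hv (hI.trans hsub), ?_⟩
          rw [← isNClique_compl] at hIc ⊢
          refine hIc.insert fun w hw => ?_
          have := mem_filter.1 (hI hw)
          exact (compl_adj _ _ _).2 ⟨(ne_of_mem_erase this.1).symm, this.2⟩

/-- The vertices with no neighbour in `J`. An independent `J` is contained in this set. -/
noncomputable def commonNonneighbors [Fintype V] (G : SimpleGraph V) (J : Finset V) : Finset V :=
  {v | ∀ a ∈ J, ¬ G.Adj a v}

section

variable [Fintype V]

theorem mem_commonNonneighbors {J : Finset V} {v : V} :
    v ∈ G.commonNonneighbors J ↔ ∀ a ∈ J, ¬ G.Adj a v := by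
  simp [commonNonneighbors]

theorem commonNonneighbors_anti {J K : Finset V} (h : J ⊆ K) :
    G.commonNonneighbors K ⊆ G.commonNonneighbors J := fun _ hv =>
  mem_commonNonneighbors.2 fun a ha => mem_commonNonneighbors.1 hv a (h ha)

/-- An independent `r`-set and its common non-neighbours form a book in the complement. -/
theorem IsNIndepSet.isContained_bookGraph {r : ℕ} {J : Finset V} (hJ : G.IsNIndepSet r J) :
    (bookGraph r #(G.commonNonneighbors J \ J)).IsContained Gᶜ := by
  set X := G.commonNonneighbors J \ J with hX
  let e : Fin r ≃ J := (J.equivFinOfCardEq hJ.card_eq).symm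
  let g : Fin #X ≃ X := X.equivFin.symm
  have hgJ : ∀ i, (g i : V) ∉ J := fun i => (mem_sdiff.1 (g i).2).2
  have hg : ∀ i, ∀ a ∈ J, ¬ G.Adj a (g i) := fun i =>
    mem_commonNonneighbors.1 (mem_sdiff.1 (g i).2).1
  have hne : ∀ i j, (e i : V) ≠ g j := fun i j h => hgJ j (h ▸ (e i).2)
  refine ⟨⟨⟨Sum.elim (fun i => e i) (fun i => g i), ?_⟩, ?_⟩⟩
  · rintro (i | i) (j | j) ⟨hij, hl⟩
    · refine (compl_adj _ _ _).2 ⟨fun h => hij ?_, hJ.isIndepSet.not_adj (e i).2 (e j).2⟩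
      rw [e.injective (Subtype.ext h)]
    · exact (compl_adj _ _ _).2 ⟨hne i j, hg j _ (e i).2⟩
    · exact (compl_adj _ _ _).2 ⟨(hne j i).symm, fun h => hg i _ (e j).2 h.symm⟩
    · simp at hl
  · rintro (i | i) (j | j) h
    · rw [e.injective (Subtype.ext h)]
    · exact (hne i j h).elim
    · exact (hne j i h.symm).elim
    · rw [g.injective (Subtype.ext h)]

/-- The complement of `G` has no `r`-book with more than `n / p` pages, expressed through common
non-neighbours; the term `p * r` pays for the base, which is among its own non-neighbours. -/
def BookBounded (G : SimpleGraph V) (r p : ℕ) : Prop :=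
  ∀ J : Finset V, G.IsNIndepSet r J →
    p * #(G.commonNonneighbors J) ≤ Fintype.card V + p * r

theorem bookBounded_of_bookSize_le {r p : ℕ} (h : p * bookSize r Gᶜ ≤ Fintype.card V) :
    G.BookBounded r p := by
  intro J hJ
  have h1 := le_bookSize hJ.isContained_bookGraph
  have h2 := le_card_sdiff J (G.commonNonneighbors J)
  rw [hJ.card_eq] at h2
  calc p * #(G.commonNonneighbors J) ≤ p * (bookSize r Gᶜ + r) := by gcongr; omega
    _ ≤ _ := by rw [mul_add]; omega

theorem BookBounded.mul_card_le_of_isIndepSet {r p : ℕ} (h : G.BookBounded r p) {I : Finset V}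
    (hI : G.IsIndepSet I) : p * #I ≤ Fintype.card V + p * r := by
  rcases le_or_gt r #I with hr | hr
  · obtain ⟨J, hJI, hJ⟩ := exists_subset_card_eq hr
    refine le_trans ?_ (h J ⟨hI.mono (by exact_mod_cast hJI), hJ⟩)
    gcongr
    intro v hv
    exact mem_commonNonneighbors.2 fun a ha => hI.not_adj (hJI ha) hv
  · have : p * #I ≤ p * r := by gcongr
    omega

end

/-! ### Complete multipartite induced subgraphs -/

/-- A family of independent `m`-sets, any two of them completely joined: the parts of an induced
complete multipartite subgraph with all parts of size `m`. -/
structure IsIndepBlowup (G : SimpleGraph V) (m : ℕ) {ι : Type*} (M : ι → Finset V) : Prop where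
  isNIndepSet : ∀ i, G.IsNIndepSet m (M i)
  adj : ∀ i j, i ≠ j → ∀ a ∈ M i, ∀ b ∈ M j, G.Adj a b

/-- `t * r` vertices split into `t` disjoint blocks of size `r`. -/
theorem exists_pairwiseDisjoint_blocks (t r : ℕ) (U : Finset V) (hU : #U = t * r) :
    ∃ B : Fin t → Finset V,
      (∀ s, B s ⊆ U ∧ #(B s) = r) ∧ ∀ s s', s ≠ s' → Disjoint (B s) (B s') := by
  let e : U ≃ Fin t × Fin r := (U.equivFinOfCardEq hU).trans finProdFinEquiv.symm
  have hinj : ∀ s, Function.Injective fun b : Fin r => (e.symm (s, b) : V) := fun s b b' h => by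
    simpa using e.symm.injective (Subtype.ext h)
  refine ⟨fun s => univ.image fun b => (e.symm (s, b) : V), fun s => ⟨?_, ?_⟩, ?_⟩
  · intro v hv
    obtain ⟨b, -, rfl⟩ := mem_image.1 hv
    exact (e.symm (s, b)).2
  · rw [card_image_of_injective _ (hinj s), card_univ, Fintype.card_fin]
  · intro s s' hs
    rw [Finset.disjoint_left]
    intro v hv hv'
    obtain ⟨b, -, rfl⟩ := mem_image.1 hv
    obtain ⟨b', -, h⟩ := mem_image.1 hv'
    have := e.symm.injective (Subtype.ext h)
    simp only [Prod.mk.injEq] at this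
    exact hs this.1.symm

/-- A vertex with `d` neighbours in `U` has a neighbour in at most `d` of the disjoint blocks. -/
theorem card_blocks_le [Fintype V] {t : ℕ} {U : Finset V} {B : Fin t → Finset V}
    (hBU : ∀ s, B s ⊆ U) (hB : ∀ s s', s ≠ s' → Disjoint (B s) (B s')) (v : V) :
    t ≤ #{s | v ∈ G.commonNonneighbors (B s)} + #{a ∈ U | G.Adj a v} := by
  have hsplit := card_filter_add_card_filter_not (s := (univ : Finset (Fin t)))
    (fun s => v ∈ G.commonNonneighbors (B s))
  rw [card_univ, Fintype.card_fin] at hsplit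
  suffices #{s | v ∉ G.commonNonneighbors (B s)} ≤ #{a ∈ U | G.Adj a v} by omega
  have hex : ∀ s, v ∉ G.commonNonneighbors (B s) → ∃ a ∈ B s, G.Adj a v := fun s hs => by
    simpa [mem_commonNonneighbors] using hs
  refine card_le_card_of_forall_subsingleton (fun s a => a ∈ B s) ?_ ?_
  · intro s hs
    obtain ⟨a, ha, hav⟩ := hex s (mem_filter.1 hs).2
    exact ⟨a, mem_filter.2 ⟨hBU s ha, hav⟩, ha⟩
  · rintro a - s ⟨-, hs⟩ s' ⟨-, hs'⟩
    by_contra hne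
    exact Finset.disjoint_left.1 (hB s s' hne) hs hs'

/-- If many vertices have `m'` neighbours in every part of a blow-up, then some large subset of them
has the same neighbours there, and Ramsey's theorem provides a further part. -/
theorem IsIndepBlowup.exists_cons {p m m' k N : ℕ} (hG : G.CliqueFree (p + 1))
    (hN : ∀ U : Finset V, N ≤ #U →
      (∃ K ⊆ U, G.IsNClique (p + 1) K) ∨ ∃ I ⊆ U, G.IsNIndepSet m' I)
    {M : Fin k → Finset V} (hM : G.IsIndepBlowup m M) {W : Finset V}
    (hW : ∀ v ∈ W, ∀ i, m' ≤ #{a ∈ M i | G.Adj a v}) (hWcard : 2 ^ (k * m) * N < #W) :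
    ∃ M' : Fin (k + 1) → Finset V, G.IsIndepBlowup m' M' := by
  set S : Finset V := univ.biUnion M with hS
  have hScard : #S ≤ k * m := by
    refine card_biUnion_le.trans ?_
    simp [(hM.isNIndepSet _).card_eq]
  have hpow : #S.powerset * N < #W := by
    refine lt_of_le_of_lt ?_ hWcard
    rw [card_powerset]
    gcongr
    norm_num
  obtain ⟨T, -, hT⟩ := exists_lt_card_fiber_of_mul_lt_card_of_maps_to
    (f := fun v => {a ∈ S | G.Adj a v}) (fun v _ => mem_powerset.2 (filter_subset _ S)) hpow
  rcases hN _ hT.le with ⟨K, -, hK⟩ | ⟨I, hI, hIm⟩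
  · exact (hG K hK).elim
  have hTadj : ∀ v ∈ {v ∈ W | {a ∈ S | G.Adj a v} = T}, ∀ a ∈ T, G.Adj a v := fun v hv a ha => by
    rw [← (mem_filter.1 hv).2] at ha
    exact (mem_filter.1 ha).2
  have hex : ∀ i, ∃ A ⊆ M i ∩ T, #A = m' := fun i => by
    obtain ⟨v, hv⟩ : ({v ∈ W | {a ∈ S | G.Adj a v} = T} : Finset V).Nonempty :=
      card_pos.1 (by omega)
    refine exists_subset_card_eq ((hW v (mem_filter.1 hv).1 i).trans (card_le_card ?_))
    intro a ha
    rw [mem_filter] at ha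
    refine mem_inter.2 ⟨ha.1, ?_⟩
    rw [← (mem_filter.1 hv).2]
    exact mem_filter.2 ⟨mem_biUnion.2 ⟨i, mem_univ _, ha.1⟩, ha.2⟩
  choose A hA hAcard using hex
  have hAM : ∀ i, A i ⊆ M i := fun i => (hA i).trans inter_subset_left
  have hAI : ∀ i, ∀ a ∈ A i, ∀ b ∈ I, G.Adj a b := fun i a ha b hb =>
    hTadj b (hI hb) a (mem_inter.1 (hA i ha)).2
  refine ⟨Fin.cons I A, fun i => ?_, fun i j => ?_⟩
  · cases i using Fin.cases with
    | zero => exact hIm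
    | succ i =>
      exact ⟨(hM.isNIndepSet i).isIndepSet.mono (by exact_mod_cast hAM i), hAcard i⟩
  · cases i using Fin.cases with
    | zero =>
      cases j using Fin.cases with
      | zero => simp
      | succ j => exact fun _ a ha b hb => (hAI j b hb a ha).symm
    | succ i =>
      cases j using Fin.cases with
      | zero => exact fun _ a ha b hb => hAI i a ha b hb
      | succ j =>
        exact fun hij a ha b hb =>
          hM.adj i j (fun h => hij (congrArg Fin.succ h)) a (hAM i ha) b (hAM j hb)

section

variable [Fintype V]

/-- Given a blow-up with `k < p` parts in which only `C` vertices have `m'` neighbours in every part,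
`V` is small. Split each part into `2 * p * m'` blocks of size `r`; every other vertex is nonadjacent
to most of the blocks of some part, so in a large `V` an average block would have more than `n / p`
common non-neighbours. -/
theorem IsIndepBlowup.card_le_of_bookBounded {r p k m' : ℕ} (hB : G.BookBounded r p) (hk : k < p)
    (hm' : 0 < m') {M : Fin k → Finset V} (hM : G.IsIndepBlowup (2 * p * m' * r) M) {C : ℕ}
    (hC : #{v | ∀ i, m' ≤ #{a ∈ M i | G.Adj a v}} ≤ C) :
    Fintype.card V ≤ 2 * p * C + 2 * p * (p * r) := by
  set n := Fintype.card V
  set t := 2 * p * m' with ht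
  have hblocks := fun i =>
    exists_pairwiseDisjoint_blocks t r (M i) (hM.isNIndepSet i).card_eq
  choose B hBM hBdisj using hblocks
  have hBindep : ∀ i s, G.IsNIndepSet r (B i s) := fun i s =>
    ⟨(hM.isNIndepSet i).isIndepSet.mono (by exact_mod_cast (hBM i s).1), (hBM i s).2⟩
  -- Upper bound for the number of pairs of a block and a common non-neighbour of it.
  have hupper : p * ∑ x : Fin k × Fin t, #(G.commonNonneighbors (B x.1 x.2)) ≤
      k * t * (n + p * r) := by
    rw [mul_sum]
    refine (sum_le_card_nsmul _ _ (n + p * r) fun x _ => hB _ (hBindep x.1 x.2)).trans ?_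
    simp
  -- Lower bound for the same number.
  have hlower : (n - C) * (t - m') ≤
      ∑ x : Fin k × Fin t, #(G.commonNonneighbors (B x.1 x.2)) := by
    have hcomm : ∑ x : Fin k × Fin t, #(G.commonNonneighbors (B x.1 x.2)) =
        ∑ v : V, #{x : Fin k × Fin t | v ∈ G.commonNonneighbors (B x.1 x.2)} := by
      have := sum_card_bipartiteAbove_eq_sum_card_bipartiteBelow
        (s := (univ : Finset (Fin k × Fin t))) (t := (univ : Finset V))
        (fun x v => v ∈ G.commonNonneighbors (B x.1 x.2))
      simpa [bipartiteAbove, bipartiteBelow] using this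
    rw [hcomm]
    set W : Finset V := {v | ∀ i, m' ≤ #{a ∈ M i | G.Adj a v}} with hWdef
    calc (n - C) * (t - m') ≤ #Wᶜ * (t - m') := by
          gcongr
          rw [card_compl]
          omega
      _ ≤ ∑ v ∈ Wᶜ, #{x : Fin k × Fin t | v ∈ G.commonNonneighbors (B x.1 x.2)} := by
          rw [← smul_eq_mul]
          refine card_nsmul_le_sum _ _ _ fun v hv => ?_
          have : ∃ i, #{a ∈ M i | G.Adj a v} < m' := by simpa [hWdef] using hv
          obtain ⟨i, hi⟩ := this
          have h1 := card_blocks_le (G := G) (fun s => (hBM i s).1) (hBdisj i) v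
          have h2 : #{s | v ∈ G.commonNonneighbors (B i s)} ≤
              #{x : Fin k × Fin t | v ∈ G.commonNonneighbors (B x.1 x.2)} :=
            card_le_card_of_injOn (fun s => (i, s)) (fun s hs => by simpa using hs)
              (fun s _ s' _ h => by simpa using h)
          omega
      _ ≤ _ := sum_le_sum_of_subset (subset_univ _)
  have hkey : p * ((n - C) * (t - m')) ≤ k * t * (n + p * r) :=
    (Nat.mul_le_mul_left p hlower).trans hupper
  rcases le_or_gt n C with hnC | hnC
  · have : 1 * C ≤ 2 * p * C := by gcongr; omega
    linarith [Nat.zero_le (2 * p * (p * r))]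
  obtain ⟨d, rfl⟩ : ∃ d, p = d + 1 := ⟨p - 1, by omega⟩
  obtain ⟨x, hx⟩ : ∃ x, n = C + x := ⟨n - C, by omega⟩
  have ht' : t - m' = (2 * d + 1) * m' := by rw [ht]; ring_nf; omega
  have hkd : k * t * (n + (d + 1) * r) ≤ d * t * (n + (d + 1) * r) := by gcongr; omega
  rw [ht', hx, Nat.add_sub_cancel_left] at hkey
  rw [hx] at hkd ⊢
  have h3 := hkey.trans hkd
  -- After cancelling `p * m'`, the coefficients of `n` are `2 * p - 1` and `2 * p - 2`.
  have h4 : ((d + 1) * m') * ((2 * d + 1) * x) ≤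
      ((d + 1) * m') * (2 * d * (C + x + (d + 1) * r)) := by
    calc _ = (d + 1) * (x * ((2 * d + 1) * m')) := by ring
      _ ≤ _ := h3
      _ = _ := by rw [ht]; ring
  have h5 := Nat.le_of_mul_le_mul_left h4 (by positivity)
  nlinarith

/-- A large `K_{p+1}`-free graph whose complement has only small books contains every bounded
complete multipartite graph with at most `p` parts as an induced subgraph. -/
theorem exists_isIndepBlowup (r p k m : ℕ) (hk : k ≤ p) :
    ∃ n₀ : ℕ, ∀ (V : Type*) [Fintype V] (G : SimpleGraph V), G.CliqueFree (p + 1) →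
      G.BookBounded r p → n₀ ≤ Fintype.card V → ∃ M : Fin k → Finset V, G.IsIndepBlowup m M := by
  induction k generalizing m with
  | zero => exact ⟨0, fun V _ G _ _ _ => ⟨Fin.elim0, fun i => i.elim0, fun i => i.elim0⟩⟩
  | succ k ih =>
    -- The size `m + 1` in place of `m` makes the threshold `m'` of `card_le_of_bookBounded` positive.
    obtain ⟨N, hN⟩ := exists_forall_isNClique_or_isNIndepSet (p + 1) (m + 1)
    obtain ⟨n₀, hn₀⟩ := ih (2 * p * (m + 1) * r) (by omega)
    set C := 2 ^ (k * (2 * p * (m + 1) * r)) * N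
    refine ⟨n₀ + (2 * p * C + 2 * p * (p * r)) + 1, fun V _ G hG hB hV => ?_⟩
    obtain ⟨M, hM⟩ := hn₀ V G hG hB (by omega)
    have hW : C < #{v | ∀ i, m + 1 ≤ #{a ∈ M i | G.Adj a v}} := by
      by_contra! h
      have := hM.card_le_of_bookBounded hB (by omega) (by omega) h
      omega
    obtain ⟨M', hM'⟩ := hM.exists_cons hG (hN V G) (fun v hv => (mem_filter.1 hv).2) hW
    choose A hA hAcard using fun i => exists_subset_card_eq (n := m) (s := M' i)
      (by rw [(hM'.isNIndepSet i).card_eq]; omega)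
    exact ⟨A, fun i => ⟨(hM'.isNIndepSet i).isIndepSet.mono (by exact_mod_cast hA i), hAcard i⟩,
      fun i j hij a ha b hb => hM'.adj i j hij a (hA i ha) b (hA j hb)⟩

end

/-! ### The partition into independent sets -/

theorem CliqueFree.exists_not_adj {p : ℕ} (hG : G.CliqueFree (p + 1)) {a : Fin p → V}
    (ha : ∀ i j, i ≠ j → G.Adj (a i) (a j)) (v : V) : ∃ i, ¬ G.Adj v (a i) := by
  by_contra! hv
  have hinj : Function.Injective a := fun i j h => by
    by_contra hij
    exact (ha i j hij).ne h
  refine hG (insert v (univ.image a)) (IsNClique.insert ⟨?_, ?_⟩ ?_)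
  · intro x hx y hy hxy
    obtain ⟨i, -, rfl⟩ := mem_image.1 (mem_coe.1 hx)
    obtain ⟨j, -, rfl⟩ := mem_image.1 (mem_coe.1 hy)
    exact ha i j fun h => hxy (congrArg a h)
  · rw [card_image_of_injective _ hinj, card_univ, Fintype.card_fin]
  · intro b hb
    obtain ⟨i, -, rfl⟩ := mem_image.1 hb
    exact hv i

section

variable [Fintype V]

/-- In a `K_{p+1}`-free graph no vertex has a neighbour in each of the `p` parts of a blow-up. -/
theorem IsIndepBlowup.exists_mem_commonNonneighbors {p m : ℕ} (hG : G.CliqueFree (p + 1))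
    {M : Fin p → Finset V} (hM : G.IsIndepBlowup m M) (v : V) :
    ∃ i, v ∈ G.commonNonneighbors (M i) := by
  by_contra! h
  have hex : ∀ i, ∃ a ∈ M i, G.Adj a v := fun i => by
    simpa [mem_commonNonneighbors] using h i
  choose a haM hav using hex
  obtain ⟨i, hi⟩ := hG.exists_not_adj (a := a)
    (fun i j hij => hM.adj i j hij _ (haM i) _ (haM j)) v
  exact hi (hav i).symm

/-- If every `r`-subset of `U` has at most `c` common non-neighbours in `X`, then few vertices of
`X` have `r` or more non-neighbours in `U`. -/
theorem card_filter_le_card_nonneighbors {r c : ℕ} {U X : Finset V}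
    (h : ∀ J ⊆ U, #J = r → #(G.commonNonneighbors J ∩ X) ≤ c) :
    #{w ∈ X | r ≤ #{a ∈ U | ¬ G.Adj a w}} ≤ 2 ^ #U * c := by
  have hsub : ({w ∈ X | r ≤ #{a ∈ U | ¬ G.Adj a w}} : Finset V) ⊆
      (U.powersetCard r).biUnion fun J => G.commonNonneighbors J ∩ X := by
    intro w hw
    obtain ⟨hwX, hw⟩ := mem_filter.1 hw
    obtain ⟨J, hJ, hJr⟩ := exists_subset_card_eq hw
    refine mem_biUnion.2 ⟨J, mem_powersetCard.2 ⟨hJ.trans (filter_subset _ _), hJr⟩, ?_⟩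
    exact mem_inter.2 ⟨mem_commonNonneighbors.2 fun a ha => (mem_filter.1 (hJ ha)).2, hwX⟩
  calc _ ≤ _ := card_le_card hsub
    _ ≤ #(U.powersetCard r) * c := card_biUnion_le_card_mul _ _ _ fun J hJ =>
        h J (mem_powersetCard.1 hJ).1 (mem_powersetCard.1 hJ).2
    _ ≤ 2 ^ #U * c := by
        gcongr
        rw [card_powersetCard]
        exact Nat.choose_le_two_pow _ _

/-- The non-neighbourhoods of two different parts hardly overlap, even if one of the parts is
replaced by an `r`-subset: the `p` sets of non-neighbours cover `V` and have size at most
`n / p + r` each. -/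
theorem IsIndepBlowup.card_inter_commonNonneighbors_le {r p m : ℕ} (hG : G.CliqueFree (p + 1))
    (hB : G.BookBounded r p) (hrm : r ≤ m) {M : Fin p → Finset V} (hM : G.IsIndepBlowup m M)
    {i j : Fin p} (hij : i ≠ j) {J : Finset V} (hJ : J ⊆ M j) (hJr : #J = r) :
    #(G.commonNonneighbors J ∩ G.commonNonneighbors (M i)) ≤ p * r := by
  set D := fun l => G.commonNonneighbors (M l) with hD
  have hDle : ∀ l, p * #(D l) ≤ Fintype.card V + p * r := fun l => by
    obtain ⟨J', hJ', hJr'⟩ := exists_subset_card_eq (n := r) (s := M l)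
      (by rwa [(hM.isNIndepSet l).card_eq])
    refine le_trans ?_ (hB J' ⟨(hM.isNIndepSet l).isIndepSet.mono (by exact_mod_cast hJ'), hJr'⟩)
    gcongr
    exact commonNonneighbors_anti hJ'
  have hJle := hB J ⟨(hM.isNIndepSet j).isIndepSet.mono (by exact_mod_cast hJ), hJr⟩
  have hcover : (univ : Finset V) ⊆
      (G.commonNonneighbors J \ D i) ∪ (univ.erase j).biUnion D := by
    intro v _
    obtain ⟨l, hl⟩ := hM.exists_mem_commonNonneighbors hG v
    simp only [mem_union, mem_sdiff, mem_biUnion, mem_erase, mem_univ, and_true]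
    by_cases hlj : l = j
    · subst hlj
      by_cases hi : v ∈ D i
      · exact .inr ⟨i, hij, hi⟩
      · exact .inl ⟨commonNonneighbors_anti hJ hl, hi⟩
    · exact .inr ⟨l, hlj, hl⟩
  have h1 := (card_le_card hcover).trans (card_union_le _ _)
  rw [card_univ] at h1
  have h2 := card_sdiff_add_card_inter (G.commonNonneighbors J) (D i)
  have h3 : p * #((univ.erase j).biUnion D) ≤ (p - 1) * (Fintype.card V + p * r) := by
    calc _ ≤ p * ∑ l ∈ univ.erase j, #(D l) := by gcongr; exact card_biUnion_le
      _ ≤ #(univ.erase j) • (Fintype.card V + p * r) := by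
          rw [mul_sum]
          exact sum_le_card_nsmul _ _ _ fun l _ => hDle l
      _ = _ := by simp
  obtain ⟨d, rfl⟩ : ∃ d, p = d + 1 := ⟨p - 1, by have := i.2; omega⟩
  rw [Nat.add_sub_cancel] at h3
  refine Nat.le_of_mul_le_mul_left (c := d + 1) ?_ (by omega)
  nlinarith

/-- Apart from boundedly many vertices, a large `K_{p+1}`-free graph whose complement has only small
books is partitioned into `p` independent sets of size `n / p` up to a bounded error. The `i`-th set
consists of the vertices with no neighbour in the `i`-th part of a blow-up and with fewer than `r`
non-neighbours in each of the other parts. -/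
theorem exists_isIndepSet_partition (r p : ℕ) :
    ∃ C n₀ : ℕ, ∀ (V : Type*) [Fintype V] (G : SimpleGraph V), G.CliqueFree (p + 1) →
      G.BookBounded r p → n₀ ≤ Fintype.card V → ∃ P : Fin p → Finset V,
        (∀ i, G.IsIndepSet (P i)) ∧ (∀ i j, i ≠ j → Disjoint (P i) (P j)) ∧
        Fintype.card V ≤ #(univ.biUnion P) + C ∧ ∀ i, Fintype.card V ≤ p * #(P i) + C := by
  obtain ⟨n₀, hn₀⟩ := exists_isIndepBlowup r p p (2 * r) le_rfl
  set C₀ := p * p * (2 ^ (2 * r) * (p * r)) with hC₀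
  refine ⟨p * (p * r) + (p + 1) * C₀, n₀, fun V _ G hG hB hV => ?_⟩
  obtain ⟨M, hM⟩ := hn₀ V G hG hB hV
  set n := Fintype.card V
  set P : Fin p → Finset V := fun i =>
    {v ∈ G.commonNonneighbors (M i) | ∀ j, j ≠ i → #{a ∈ M j | ¬ G.Adj a v} < r} with hP
  have hindep : ∀ i, G.IsIndepSet (P i) := by
    intro i u hu v hv _ huv
    have hu' := (mem_filter.1 (mem_coe.1 hu)).2
    have hv' := (mem_filter.1 (mem_coe.1 hv)).2
    -- Adjacent `u`, `v` in `P i` have a common neighbour in each `M j` with `j ≠ i`; these, `u` and `v`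
    -- form a clique.
    have hex : ∀ j, ∃ a, (j = i → a = u) ∧ (j ≠ i → a ∈ M j ∧ G.Adj a u) ∧ G.Adj a v := by
      intro j
      by_cases hj : j = i
      · exact ⟨u, fun _ => rfl, fun h => (h hj).elim, huv⟩
      · by_contra! hcon
        have hsub : M j ⊆ {a ∈ M j | ¬ G.Adj a u} ∪ {a ∈ M j | ¬ G.Adj a v} := by
          intro a ha
          by_cases hau : G.Adj a u
          · exact mem_union_right _ (mem_filter.2
              ⟨ha, hcon a (fun h => (hj h).elim) fun _ => ⟨ha, hau⟩⟩)
          · exact mem_union_left _ (mem_filter.2 ⟨ha, hau⟩)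
        have := (card_le_card hsub).trans (card_union_le _ _)
        rw [(hM.isNIndepSet j).card_eq] at this
        have := hu' j hj
        have := hv' j hj
        omega
    choose a hai haj hav using hex
    obtain ⟨l, hl⟩ := hG.exists_not_adj (a := a) (v := v) (fun j k hjk => by
      by_cases hj : j = i
      · rw [hai j hj]
        exact (haj k fun hk => hjk (hj.trans hk.symm)).2.symm
      · by_cases hk : k = i
        · rw [hai k hk]
          exact (haj j hj).2
        · exact hM.adj j k hjk _ (haj j hj).1 _ (haj k hk).1)
    exact hl (hav l).symm
  have hdisj : ∀ i j, i ≠ j → Disjoint (P i) (P j) := by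
    intro i j hij
    rw [Finset.disjoint_left]
    intro v hvi hvj
    have h1 := (mem_filter.1 hvi).2 j hij.symm
    have h2 := mem_commonNonneighbors.1 (mem_filter.1 hvj).1
    rw [filter_true_of_mem h2, (hM.isNIndepSet j).card_eq] at h1
    omega
  have hcover : n ≤ #(univ.biUnion P) + C₀ := by
    -- A vertex outside all `P i` has no neighbour in some `M i` and `r` non-neighbours in some `M j`.
    have hsub : (univ : Finset V) ⊆ univ.biUnion P ∪
        ((univ : Finset (Fin p × Fin p)).filter fun x => x.1 ≠ x.2).biUnion fun x =>
          {w ∈ G.commonNonneighbors (M x.1) | r ≤ #{a ∈ M x.2 | ¬ G.Adj a w}} := by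
      intro v _
      by_cases hv : v ∈ univ.biUnion P
      · exact mem_union_left _ hv
      · obtain ⟨i, hi⟩ := hM.exists_mem_commonNonneighbors hG v
        have hvi : v ∉ P i := fun h => hv (mem_biUnion.2 ⟨i, mem_univ _, h⟩)
        have : ∃ j, j ≠ i ∧ r ≤ #{a ∈ M j | ¬ G.Adj a v} := by
          by_contra! hcon
          exact hvi (mem_filter.2 ⟨hi, hcon⟩)
        obtain ⟨j, hj, hjr⟩ := this
        exact mem_union_right _ (mem_biUnion.2
          ⟨(i, j), mem_filter.2 ⟨mem_univ _, hj.symm⟩, mem_filter.2 ⟨hi, hjr⟩⟩)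
    have h1 := (card_le_card hsub).trans (card_union_le _ _)
    rw [card_univ] at h1
    refine h1.trans (Nat.add_le_add_left ?_ _)
    refine (card_biUnion_le_card_mul _ _ (2 ^ (2 * r) * (p * r)) fun x hx => ?_).trans ?_
    · rw [← (hM.isNIndepSet x.2).card_eq]
      exact card_filter_le_card_nonneighbors fun J hJ hJr =>
        hM.card_inter_commonNonneighbors_le hG hB (by omega) (mem_filter.1 hx).2 hJ hJr
    · rw [hC₀]
      gcongr
      exact (card_le_univ _).trans (by simp)
  refine ⟨P, hindep, hdisj, hcover.trans (by rw [add_mul]; omega), fun i => ?_⟩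
  have hPle : ∀ l, p * #(P l) ≤ n + p * r := fun l =>
    hB.mul_card_le_of_isIndepSet (hindep l)
  have h1 : p * #(univ.biUnion P) ≤ p * #(P i) + (p - 1) * (n + p * r) := by
    calc p * #(univ.biUnion P) ≤ p * ∑ l, #(P l) := by gcongr; exact card_biUnion_le
      _ = p * #(P i) + ∑ l ∈ univ.erase i, p * #(P l) := by
          rw [← add_sum_erase _ _ (mem_univ i), mul_add, mul_sum]
      _ ≤ p * #(P i) + #(univ.erase i) • (n + p * r) := by
          gcongr
          exact sum_le_card_nsmul _ _ _ fun l _ => hPle l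
      _ = _ := by simp
  obtain ⟨d, rfl⟩ : ∃ d, p = d + 1 := ⟨p - 1, by have := i.2; omega⟩
  rw [Nat.add_sub_cancel] at h1
  have h2 := Nat.mul_le_mul_left (d + 1) hcover
  nlinarith

/-! ### Removing the vertices of small degree -/

/-- Double counting of the non-adjacent pairs between `U` and `X`: most vertices of `X` have fewer
than `r` non-neighbours in `U`. -/
theorem sum_card_nonneighbors_le {r c : ℕ} {U X : Finset V}
    (h : ∀ J ⊆ U, #J = r → #(G.commonNonneighbors J ∩ X) ≤ c) :
    ∑ u ∈ U, #{w ∈ X | ¬ G.Adj u w} ≤ r * #X + #U * (2 ^ #U * c) := by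
  have hcomm := sum_card_bipartiteAbove_eq_sum_card_bipartiteBelow (s := U) (t := X)
    (fun u w => ¬ G.Adj u w)
  simp only [bipartiteAbove, bipartiteBelow] at hcomm
  rw [hcomm]
  calc _ ≤ ∑ w ∈ X, (r + if r ≤ #{a ∈ U | ¬ G.Adj a w} then #U else 0) := by
        refine sum_le_sum fun w _ => ?_
        split_ifs with hw
        · exact (card_filter_le _ _).trans (by omega)
        · omega
    _ = r * #X + #U * #{w ∈ X | r ≤ #{a ∈ U | ¬ G.Adj a w}} := by
        rw [sum_add_distrib, ← sum_filter, sum_const, sum_const, smul_eq_mul, smul_eq_mul,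
          mul_comm r, mul_comm #U]
    _ ≤ _ := by
        gcongr
        exact card_filter_le_card_nonneighbors h

/-- If the common non-neighbours in `X` of the `r`-subsets of `A` are bounded in number, then so are
the vertices of `A` nonadjacent to a fixed proportion `η` of all vertices within `X`. -/
theorem exists_card_nonneighbors_le (r c : ℕ) (hr : 0 < r) {η : ℝ} (hη : 0 < η) :
    ∃ K n₀ : ℕ, ∀ (V : Type*) [Fintype V] (G : SimpleGraph V) (A X : Finset V),
      (∀ J ⊆ A, #J = r → #(G.commonNonneighbors J ∩ X) ≤ c) → n₀ ≤ Fintype.card V →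
      #{u ∈ A | η * (Fintype.card V : ℝ) ≤ (#{w ∈ X | ¬ G.Adj u w} : ℝ)} ≤ K := by
  -- As `K * η ≥ 2 * r`, a `K`-set has at least `2 * r * n` non-neighbours in total, twice the
  -- leading term `r * n` of the upper bound.
  obtain ⟨K, hK⟩ := exists_nat_ge (2 * r / η)
  rw [div_le_iff₀ hη] at hK
  refine ⟨K, K * (2 ^ K * c) + 1, fun V _ G A X h hV => ?_⟩
  by_contra! hcon
  obtain ⟨U, hU, hUK⟩ := exists_subset_card_eq hcon.le
  have h1 := sum_card_nonneighbors_le (G := G) (U := U) (X := X) fun J hJ =>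
    h J (hJ.trans (hU.trans (filter_subset _ _)))
  have h2 : (K : ℝ) * (η * Fintype.card V) ≤ ∑ u ∈ U, (#{w ∈ X | ¬ G.Adj u w} : ℝ) := by
    rw [← hUK, ← nsmul_eq_mul]
    exact card_nsmul_le_sum _ _ _ fun u hu => (mem_filter.1 (hU hu)).2
  have h3 : r * #X ≤ r * Fintype.card V := by gcongr; exact card_le_univ _
  rw [hUK] at h1
  have h4 : (K : ℝ) * (η * Fintype.card V) ≤ (r * Fintype.card V + K * (2 ^ K * c) : ℕ) :=
    h2.trans (by exact_mod_cast h1.trans (by omega))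
  have h5 : (2 * r : ℝ) * Fintype.card V ≤ K * η * Fintype.card V := by gcongr
  have h6 : ((2 * r * Fintype.card V : ℕ) : ℝ) ≤ (r * Fintype.card V + K * (2 ^ K * c) : ℕ) := by
    refine le_trans ?_ h4
    push_cast
    linarith
  rw [Nat.cast_le] at h6
  have h7 : 1 * Fintype.card V ≤ r * Fintype.card V := by gcongr; omega
  rw [mul_assoc] at h6
  omega

/-- A large `K_{p+1}`-free graph whose complement has only small books has an almost spanning
`p`-colourable induced subgraph of large minimum degree. -/
theorem exists_colorable_induce (r p : ℕ) (hr : 0 < r) (hp : 0 < p) {ξ : ℝ} (hξ : 0 < ξ) :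
    ∃ n₀ : ℕ, ∀ (V : Type*) [Fintype V] (G : SimpleGraph V), G.CliqueFree (p + 1) →
      G.BookBounded r p → n₀ ≤ Fintype.card V → ∃ s : Finset V,
        (1 - ξ) * Fintype.card V ≤ (#s : ℝ) ∧ (G.induce (s : Set V)).Colorable p ∧
        ∀ v ∈ s, (1 - 1 / (p : ℝ) - 2 * ξ) * Fintype.card V ≤ (#{w ∈ s | G.Adj v w} : ℝ) := by
  obtain ⟨C, n₁, h₁⟩ := exists_isIndepSet_partition r p
  have hp0 : (0 : ℝ) < p := by exact_mod_cast hp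
  set η : ℝ := ξ / p with hη
  obtain ⟨K, n₂, h₂⟩ := exists_card_nonneighbors_le r (C + p * r) hr (η := η) (by positivity)
  obtain ⟨n₃, hn₃⟩ := exists_nat_ge ((C + p * p * K + r : ℝ) / ξ)
  rw [div_le_iff₀ hξ] at hn₃
  refine ⟨n₁ + n₂ + n₃, fun V _ G hG hB hV => ?_⟩
  obtain ⟨P, hPi, hPd, hPc, hPn⟩ := h₁ V G hG hB (by omega)
  set n := Fintype.card V with hn
  have hn₃' : (C + p * p * K + r : ℝ) ≤ ξ * n := by
    refine hn₃.trans ?_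
    rw [mul_comm]
    gcongr
    omega
  set U : Fin p × Fin p → Finset V := fun x =>
    {u ∈ P x.1 | η * n ≤ (#{w ∈ P x.2 | ¬ G.Adj u w} : ℝ)} with hU
  set I : Finset (Fin p × Fin p) := {x | x.1 ≠ x.2} with hI
  have hUK : ∀ x ∈ I, #(U x) ≤ K := by
    rintro ⟨i, j⟩ hij
    have hij : i ≠ j := (mem_filter.1 hij).2
    refine h₂ V G (P i) (P j) (fun J hJ hJr => ?_) (by omega)
    have hJi : G.IsNIndepSet r J := ⟨(hPi i).mono (by exact_mod_cast hJ), hJr⟩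
    -- The common non-neighbours of `J` include the class `P i`, which has almost `n / p` elements.
    have hsub : P i ∪ (G.commonNonneighbors J ∩ P j) ⊆ G.commonNonneighbors J :=
      union_subset (fun v hv => mem_commonNonneighbors.2 fun a ha =>
        (hPi i).not_adj (hJ ha) hv) inter_subset_left
    have hcard := card_le_card hsub
    rw [card_union_of_disjoint ((hPd i j hij).mono_right inter_subset_right)] at hcard
    have h3 := (Nat.mul_le_mul_left p hcard).trans (hB J hJi)
    have h4 := hPn i
    have h5 : 1 * #(G.commonNonneighbors J ∩ P j) ≤ p * #(G.commonNonneighbors J ∩ P j) := by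
      gcongr
      omega
    rw [mul_add] at h3
    omega
  have hUcard : #(I.biUnion U) ≤ p * p * K := by
    refine (card_biUnion_le_card_mul _ _ K hUK).trans ?_
    gcongr
    exact (card_le_univ _).trans (by simp)
  set s := univ.biUnion P \ I.biUnion U with hs
  have hscard : n ≤ #s + (C + p * p * K) := by
    have : #(univ.biUnion P) - #(I.biUnion U) ≤ #s := le_card_sdiff _ _
    omega
  have hscard' : (n : ℝ) ≤ #s + (C + p * p * K) := by exact_mod_cast hscard
  have hr0 : (0 : ℝ) ≤ r := by positivity
  refine ⟨s, by linarith, ?_, ?_⟩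
  · have hex : ∀ v : (s : Set V), ∃ i, (v : V) ∈ P i := fun v => by
      simpa using (mem_sdiff.1 v.2).1
    choose f hf using hex
    refine ⟨Coloring.mk f fun {u v} huv huv' => ?_⟩
    exact (hPi (f u)).not_adj (hf u) (huv' ▸ hf v) huv
  · intro v hv
    obtain ⟨i, -, hvi⟩ := mem_biUnion.1 (mem_sdiff.1 hv).1
    have hvU : ∀ j, j ≠ i → (#{w ∈ P j | ¬ G.Adj v w} : ℝ) ≤ η * n := fun j hj => by
      by_contra! hcon
      exact (mem_sdiff.1 hv).2 (mem_biUnion.2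
        ⟨(i, j), mem_filter.2 ⟨mem_univ _, hj.symm⟩, mem_filter.2 ⟨hvi, hcon.le⟩⟩)
    have hsub : ({w ∈ s | ¬ G.Adj v w} : Finset V) ⊆
        P i ∪ (univ.erase i).biUnion fun j => {w ∈ P j | ¬ G.Adj v w} := by
      intro w hw
      obtain ⟨hws, hvw⟩ := mem_filter.1 hw
      obtain ⟨j, -, hwj⟩ := mem_biUnion.1 (mem_sdiff.1 hws).1
      by_cases hj : j = i
      · exact mem_union_left _ (hj ▸ hwj)
      · exact mem_union_right _ (mem_biUnion.2
          ⟨j, mem_erase.2 ⟨hj, mem_univ _⟩, mem_filter.2 ⟨hwj, hvw⟩⟩)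
    have h1 : (#{w ∈ s | ¬ G.Adj v w} : ℝ) ≤
        #(P i) + ∑ j ∈ univ.erase i, (#{w ∈ P j | ¬ G.Adj v w} : ℝ) := by
      exact_mod_cast (card_le_card hsub).trans
        ((card_union_le _ _).trans (Nat.add_le_add_left card_biUnion_le _))
    have h2 : ∑ j ∈ univ.erase i, (#{w ∈ P j | ¬ G.Adj v w} : ℝ) ≤ ξ * n := by
      refine (sum_le_card_nsmul _ _ (η * n) fun j hj => hvU j (mem_erase.1 hj).1).trans ?_
      rw [nsmul_eq_mul]
      calc _ ≤ (p : ℝ) * (η * n) := by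
            gcongr
            exact (card_le_univ _).trans (by simp)
        _ = ξ * n := by rw [hη]; field_simp
    have h3 : (#(P i) : ℝ) ≤ 1 / p * n + r := by
      have : (p * #(P i) : ℝ) ≤ n + p * r := by
        exact_mod_cast hB.mul_card_le_of_isIndepSet (hPi i)
      have : (#(P i) : ℝ) ≤ (n + p * r) / p := by
        rw [le_div_iff₀ hp0]
        linarith
      refine this.trans (le_of_eq ?_)
      field_simp
    have h4 : (#{w ∈ s | G.Adj v w} : ℝ) + #{w ∈ s | ¬ G.Adj v w} = #s := by
      exact_mod_cast card_filter_add_card_filter_not (s := s) (fun w => G.Adj v w)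
    linarith

/-- The colour classes are independent sets, hence have at most `n / p + r` vertices. So for `k < p` no
almost spanning induced subgraph of a large graph is `k`-colourable. -/
theorem BookBounded.mul_card_le_of_colorable {r p k : ℕ} (hB : G.BookBounded r p) {s : Finset V}
    (hs : (G.induce (s : Set V)).Colorable k) : p * #s ≤ k * (Fintype.card V + p * r) := by
  obtain ⟨c⟩ := hs
  set I : Fin k → Finset V := fun i => {v | ∃ h : v ∈ s, c ⟨v, h⟩ = i} with hI
  have hIindep : ∀ i, G.IsIndepSet (I i) := by
    intro i u hu v hv _ huv
    obtain ⟨hus, hu⟩ := (mem_filter.1 (mem_coe.1 hu)).2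
    obtain ⟨hvs, hv⟩ := (mem_filter.1 (mem_coe.1 hv)).2
    exact c.valid (v := ⟨u, hus⟩) (w := ⟨v, hvs⟩) huv (hu.trans hv.symm)
  have hsub : s ⊆ univ.biUnion I := fun v hv =>
    mem_biUnion.2 ⟨c ⟨v, hv⟩, mem_univ _, mem_filter.2 ⟨mem_univ _, hv, rfl⟩⟩
  calc p * #s ≤ p * ∑ i, #(I i) := by
        gcongr
        exact (card_le_card hsub).trans card_biUnion_le
    _ ≤ #(univ : Finset (Fin k)) • (Fintype.card V + p * r) := by
        rw [mul_sum]
        exact sum_le_card_nsmul _ _ _ fun i _ => hB.mul_card_le_of_isIndepSet (hIindep i)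
    _ = _ := by simp

theorem degree_induce_eq_card_filter {W : Type*} {H : SimpleGraph W} (s : Finset W)
    (v : (s : Set W)) [Fintype ((H.induce (s : Set W)).neighborSet v)] :
    (H.induce (s : Set W)).degree v = #{w ∈ s | H.Adj v w} := by
  rw [← card_neighborFinset_eq_degree]
  refine card_bij (fun w _ => (w : W)) (fun w hw => ?_) (fun _ _ _ _ h => Subtype.ext h)
    fun w hw => ?_
  · exact mem_filter.2 ⟨w.2, by simpa using hw⟩
  · obtain ⟨hws, hvw⟩ := mem_filter.1 hw
    exact ⟨⟨w, hws⟩, by simpa using hvw, rfl⟩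

end

end SimpleGraph

theorem mainTheorem2 (r p : ℕ) (hr : 2 ≤ r) (hp : 2 ≤ p) (ξ : ℝ) (hξ : 0 < ξ) :
    ∃ n₀ : ℕ, ∀ n : ℕ, n₀ ≤ n →
      ∀ (G : SimpleGraph (Fin n)) [DecidableRel G.Adj], G.CliqueFree (p + 1) →
        ((n : ℝ) / (p : ℝ) < (bookSize r Gᶜ : ℝ)) ∨
        ∃ s : Finset (Fin n),
          (1 - ξ) * (n : ℝ) ≤ (s.card : ℝ) ∧
          (G.induce (s : Set (Fin n))).chromaticNumber = (p : ℕ∞) ∧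
          (1 - 1 / (p : ℝ) - 2 * ξ) * (n : ℝ) ≤
            ((G.induce (s : Set (Fin n))).minDegree : ℝ) := by
  have hp0 : (0 : ℝ) < p := by positivity
  -- The bound `ζ * p < 1` excludes colourings of the subgraph with `p - 1` colours.
  obtain ⟨ζ, hζ, hζξ, hζp⟩ : ∃ ζ : ℝ, 0 < ζ ∧ ζ ≤ ξ ∧ ζ ≤ 1 / (2 * p) :=
    ⟨min ξ (1 / (2 * p)), lt_min hξ (by positivity), min_le_left _ _, min_le_right _ _⟩
  obtain ⟨n₀, h₀⟩ := SimpleGraph.exists_colorable_induce r p (by omega) (by omega) hζ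
  refine ⟨n₀ + 2 * (p * (p * r)) + 1, fun n hn G _ hG => or_iff_not_imp_left.2 fun hbook => ?_⟩
  have hn0 : (0 : ℝ) ≤ n := by positivity
  have hB : G.BookBounded r p := by
    refine SimpleGraph.bookBounded_of_bookSize_le ?_
    rw [Fintype.card_fin]
    rw [not_lt, le_div_iff₀ hp0, mul_comm] at hbook
    exact_mod_cast hbook
  obtain ⟨s, hs, hcol, hdeg⟩ := h₀ (Fin n) G hG hB (by rw [Fintype.card_fin]; omega)
  rw [Fintype.card_fin] at hs hdeg
  have hζn : ζ * n ≤ ξ * n := by gcongr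
  have hζn' : p * (ζ * n) ≤ n / 2 := by
    calc p * (ζ * n) ≤ p * (1 / (2 * p) * n) := by gcongr
      _ = n / 2 := by field_simp
  have hncol : ¬ (G.induce (s : Set (Fin n))).Colorable (p - 1) := by
    intro hcol'
    have h1 := hB.mul_card_le_of_colorable hcol'
    rw [Fintype.card_fin] at h1
    have h2 : (p : ℝ) * s.card ≤ (p - 1) * (n + p * r) := by
      have : ((p - 1 : ℕ) : ℝ) = p - 1 := by rw [Nat.cast_sub (by omega)]; simp
      rw [← this]
      exact_mod_cast h1
    have h3 : (p : ℝ) * ((1 - ζ) * n) ≤ p * s.card := by gcongr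
    have h4 : ((2 * (p * (p * r)) + 1 : ℕ) : ℝ) ≤ n := by exact_mod_cast (by omega)
    push_cast at h4
    have h5 : (0 : ℝ) ≤ p * r := by positivity
    nlinarith
  have hsne : Nonempty (s : Set (Fin n)) := by
    by_contra hemp
    rw [not_nonempty_iff] at hemp
    exact hncol (SimpleGraph.Colorable.of_isEmpty _)
  refine ⟨s, by linarith, ?_, ?_⟩
  · obtain ⟨d, rfl⟩ : ∃ d, p = d + 1 := ⟨p - 1, by omega⟩
    rw [Nat.add_sub_cancel] at hncol
    rw [Nat.cast_add_one]
    exact SimpleGraph.chromaticNumber_eq_iff_colorable_not_colorable.2 ⟨hcol, hncol⟩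
  · obtain ⟨v, hv⟩ := (G.induce (s : Set (Fin n))).exists_minimal_degree_vertex
    rw [hv, SimpleGraph.degree_induce_eq_card_filter]
    have := hdeg v v.2
    linarith
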